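/- Throughout, ideals of C*-algebras are closed and two-sided, and $C^*$-algebras need not be unital and may be zero. A property $(P)$ of C*-algebras is isomorphism invariant if $B$ has $(P)$ whenever $A$ has $(P)$ and $B \cong A$; it admits largest ideals if every C*-algebra $A$ has an ideal $I_P(A)$ (regarded as a C*-algebra) which has $(P)$ and which contains every ideal of $A$ that has $(P)$. For an action $\alpha \colon G \to \operatorname{Aut}(A)$ of a discrete group $G$ on a C*-algebra $A$, let $C^*(G, A, \alpha)$ be the (full) crossed product, in which $A$ is embedded by $a \mapsto a \delta_1$. For an $\alpha$-invariant ideal $I \subseteq A$, regard $C^*(G, I, \alpha)$ (the crossed product by the restricted action) as a subset of $C^*(G, A, \alpha)$ through the canonical map induced by the inclusion $I \subseteq A$. If $(P)$ is isomorphism invariant and admits largest ideals, then $I_P(A)$ is $\alpha$-invariant for every action $\alpha$. **Theorem 3.4.** Let $(P)$ be a property of C*-algebras that is isomorphism invariant and admits largest ideals. Let $G$ be a discrete abelian group. Then the following are equivalent: 1. Whenever $A$ is a C*-algebra with $(P)$ and $\alpha \colon G \to \operatorname{Aut}(A)$ is any action of $G$ on $A$, then $C^*(G, A, \alpha)$ also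 has $(P)$. 2. Whenever $A$ is a C*-algebra and $\alpha \colon G \to \operatorname{Aut}(A)$ is any action of $G$ on $A$, then $C^*(G, I_P(A), \alpha) \subseteq I_P(C^*(G, A, \alpha))$. 3. Whenever $A$ is a C*-algebra and $\alpha \colon G \to \operatorname{Aut}(A)$ is any action of $G$ on $A$, then $I_P(A) \subseteq I_P(C^*(G, A, \alpha)) \cap A$. -/

import Mathlib

universe u v w

noncomputable section

/-! ## Closed two-sided ideals of C*-algebras -/

/-- A closed two-sided ideal of a C*-algebra. -/
structure ClosedIdeal (A : Type w) [NonUnitalCStarAlgebra A] extends Submodule ℂ A where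
  mul_mem_left' : ∀ (a : A) {x : A}, x ∈ carrier → a * x ∈ carrier
  mul_mem_right' : ∀ {x : A} (a : A), x ∈ carrier → x * a ∈ carrier
  isClosed' : IsClosed carrier

namespace ClosedIdeal

variable {A : Type w} [NonUnitalCStarAlgebra A]

instance : SetLike (ClosedIdeal A) A where
  coe I := I.carrier
  coe_injective I J h := by
    obtain ⟨I, _, _, _⟩ := I
    obtain ⟨J, _, _, _⟩ := J
    have : I = J := SetLike.coe_injective h
    subst this
    rfl

instance : PartialOrder (ClosedIdeal A) := PartialOrder.ofSetLike (ClosedIdeal A) A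

theorem mul_mem_left (I : ClosedIdeal A) (a : A) {x : A} (hx : x ∈ I) : a * x ∈ I :=
  I.mul_mem_left' a hx

theorem mul_mem_right (I : ClosedIdeal A) (a : A) {x : A} (hx : x ∈ I) : x * a ∈ I :=
  I.mul_mem_right' a hx

theorem isClosed (I : ClosedIdeal A) : IsClosed (I : Set A) := I.isClosed'

instance : NonUnitalSubringClass (ClosedIdeal A) A where
  add_mem {I} _ _ ha hb := I.toSubmodule.add_mem ha hb
  zero_mem I := I.toSubmodule.zero_mem
  neg_mem {I} _ ha := I.toSubmodule.neg_mem ha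
  mul_mem {I} a _ _ hb := I.mul_mem_left a hb

instance : SMulMemClass (ClosedIdeal A) ℂ A where
  smul_mem {I} c _ ha := I.toSubmodule.smul_mem c ha

/-- A closed two-sided ideal of a C*-algebra is automatically self-adjoint. -/
theorem star_mem' (I : ClosedIdeal A) {x : A} (hx : x ∈ I) : star x ∈ I := by
  rw [← SetLike.mem_coe, ← I.isClosed.closure_eq, Metric.mem_closure_iff]
  intro ε hε
  obtain ⟨δ, hδ, hδε⟩ : ∃ δ : ℝ, 0 < δ ∧ δ < ε ^ 2 := exists_between (by positivity)
  set h : A := x * star x with hh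
  have hsa : IsSelfAdjoint h := .mul_star_self x
  have hpos : ∀ t : ℝ, 0 < t ^ 2 + δ ^ 2 := fun t => by positivity
  obtain ⟨f, hf_eq⟩ : ∃ f : ℝ → ℝ, ∀ t, f t = t / (t ^ 2 + δ ^ 2) := ⟨_, fun _ => rfl⟩
  have hf : Continuous f := by
    rw [show f = fun t => t / (t ^ 2 + δ ^ 2) from funext hf_eq]
    exact Continuous.div (by fun_prop) (by fun_prop) (fun t => (hpos t).ne')
  have hf0 : f 0 = 0 := by simp [hf_eq]
  obtain ⟨k, hk_eq⟩ : ∃ k : A, k = cfcₙ f h := ⟨_, rfl⟩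
  have hk : IsSelfAdjoint k := hk_eq ▸ cfcₙ_predicate f h
  have hkI : star x * (h * k) ∈ I :=
    I.mul_mem_left _ (I.mul_mem_right _ (I.mul_mem_right _ hx))
  refine ⟨_, hkI, ?_⟩
  have mulc : ∀ p q : ℝ → ℝ, Continuous p → Continuous q → p 0 = 0 → q 0 = 0 →
      cfcₙ (fun t => p t * q t) h = cfcₙ p h * cfcₙ q h := fun p q hp hq hp0 hq0 =>
    cfcₙ_mul p q h hp.continuousOn hp0 hq.continuousOn hq0
  have hid : cfcₙ (fun t : ℝ => t) h = h := cfcₙ_id' ℝ h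
  have c1 : cfcₙ (fun t => t * f t) h = h * k := by
    rw [mulc (fun t => t) f continuous_id hf rfl hf0, hid, hk_eq]
  have c1' : cfcₙ (fun t => f t * t) h = k * h := by
    rw [mulc f (fun t => t) hf continuous_id hf0 rfl, hid, hk_eq]
  have hcomm : h * k = k * h := by
    rw [← c1, ← c1']
    congr 1
    ext t
    ring
  have key : (star (star x - star x * (h * k))) * (star x - star x * (h * k))
      = cfcₙ (fun t => t * (1 - t * f t) ^ 2) h := by
    have e0 : cfcₙ (fun t => t * (1 - t * f t) ^ 2) h
        = cfcₙ (fun t => t - t * f t * t - (t * (f t * t) - t * f t * t * (f t * t))) h := by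
      congr 1
      ext t
      ring
    have c2 : cfcₙ (fun t => t * f t * t) h = h * k * h := by
      rw [mulc (fun t => t * f t) (fun t => t) (by fun_prop) (by fun_prop) (by simp) rfl, hid, c1]
    have c3 : cfcₙ (fun t => t * (f t * t)) h = h * (k * h) := by
      rw [mulc (fun t => t) (fun t => f t * t) (by fun_prop) (by fun_prop) rfl (by simp), hid, c1']
    have c4 : cfcₙ (fun t => t * f t * t * (f t * t)) h = h * k * h * (k * h) := by
      rw [mulc (fun t => t * f t * t) (fun t => f t * t) (by fun_prop) (by fun_prop) (by simp)
        (by simp), c2, c1']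
    have subc : ∀ p q : ℝ → ℝ, Continuous p → Continuous q → p 0 = 0 → q 0 = 0 →
        cfcₙ (fun t => p t - q t) h = cfcₙ p h - cfcₙ q h := fun p q hp hq hp0 hq0 =>
      cfcₙ_sub p q h hp.continuousOn hp0 hq.continuousOn hq0
    rw [e0, subc (fun t => t - t * f t * t) (fun t => t * (f t * t) - t * f t * t * (f t * t))
        (by fun_prop) (by fun_prop) (by simp) (by simp),
      subc (fun t => t) (fun t => t * f t * t) (by fun_prop) (by fun_prop) (by simp) (by simp),
      subc (fun t => t * (f t * t)) (fun t => t * f t * t * (f t * t))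
        (by fun_prop) (by fun_prop) (by simp) (by simp), c2, c3, c4, hid]
    simp only [star_sub, star_mul, star_star, hk.star_eq, hsa.star_eq, sub_mul, mul_sub]
    have m1 : x * star x = h := hh.symm
    have m2 : ∀ y, x * (star x * y) = h * y := fun y => by rw [← mul_assoc, m1]
    have m3 : ∀ y, k * (h * y) = h * (k * y) := fun y => by rw [← mul_assoc, ← hcomm, mul_assoc]
    simp only [mul_assoc, m1, m2, m3, ← hcomm]
  have hle : ‖star x - star x * (h * k)‖ ^ 2 ≤ δ := by
    rw [sq, ← CStarRing.norm_star_mul_self, key]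
    refine norm_cfcₙ_le fun t _ => ?_
    have e1 : 1 - t * f t = δ ^ 2 / (t ^ 2 + δ ^ 2) := by
      have := (hpos t).ne'
      rw [hf_eq]
      field_simp
      ring
    rw [e1, Real.norm_eq_abs, abs_mul, abs_of_nonneg (sq_nonneg (δ ^ 2 / (t ^ 2 + δ ^ 2))),
      div_pow, ← mul_div_assoc, div_le_iff₀ (by have := hpos t; positivity)]
    have h1 : |t| * δ ≤ t ^ 2 + δ ^ 2 := by
      nlinarith [sq_nonneg (|t| - δ), sq_abs t, abs_nonneg t, sq_nonneg δ]
    have h2 : δ ^ 2 ≤ t ^ 2 + δ ^ 2 := by nlinarith [sq_nonneg t]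
    calc |t| * (δ ^ 2) ^ 2 = δ * ((|t| * δ) * δ ^ 2) := by ring
      _ ≤ δ * ((t ^ 2 + δ ^ 2) * (t ^ 2 + δ ^ 2)) := by gcongr
      _ = δ * (t ^ 2 + δ ^ 2) ^ 2 := by ring
  rw [dist_eq_norm]
  exact lt_of_pow_lt_pow_left₀ 2 hε.le (hle.trans_lt hδε)

instance : StarMemClass (ClosedIdeal A) A where
  star_mem {I} _ ha := I.star_mem' ha

/-- A closed two-sided ideal, with the restricted operations and norm, is a C*-algebra. -/
instance instNonUnitalCStarAlgebra (I : ClosedIdeal A) : NonUnitalCStarAlgebra I :=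
  NonUnitalStarSubalgebra.nonUnitalCStarAlgebra I (h_closed := I.isClosed)

/-- The inclusion of a closed ideal. -/
def incl (I : ClosedIdeal A) : I →⋆ₙₐ[ℂ] A where
  toFun x := x
  map_smul' _ _ := rfl
  map_zero' := rfl
  map_add' _ _ := rfl
  map_mul' _ _ := rfl
  map_star' _ := rfl

/-- The image of a closed ideal under an isomorphism. -/
def image {B : Type w} [NonUnitalCStarAlgebra B] (e : A ≃⋆ₐ[ℂ] B) (I : ClosedIdeal A) :
    ClosedIdeal B where
  carrier := {b | e.symm b ∈ I}
  add_mem' {a b} ha hb := by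
    simp only [Set.mem_ofPred_eq, map_add] at *
    exact add_mem ha hb
  zero_mem' := by simp only [Set.mem_ofPred_eq, map_zero]; exact zero_mem I
  smul_mem' c b hb := by
    simp only [Set.mem_ofPred_eq, map_smul] at *
    exact SMulMemClass.smul_mem c hb
  mul_mem_left' a x hx := by
    simp only [Set.mem_ofPred_eq, map_mul] at *
    exact I.mul_mem_left _ hx
  mul_mem_right' a hx := by
    simp only [Set.mem_ofPred_eq, map_mul] at *
    exact I.mul_mem_right _ hx
  isClosed' := I.isClosed.preimage (StarAlgEquiv.isometry e.symm).continuous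

/-- A closed ideal is isomorphic to its image under an isomorphism. -/
def imageEquiv {B : Type w} [NonUnitalCStarAlgebra B] (e : A ≃⋆ₐ[ℂ] B) (I : ClosedIdeal A) :
    I ≃⋆ₐ[ℂ] image e I where
  toFun x := ⟨e x, show e.symm (e x) ∈ I by rw [StarAlgEquiv.symm_apply_apply]; exact x.2⟩
  invFun y := ⟨e.symm y, y.2⟩
  left_inv x := Subtype.ext (e.symm_apply_apply x)
  right_inv y := Subtype.ext (e.apply_symm_apply y)
  map_mul' x y := Subtype.ext (map_mul e (x : A) y)
  map_add' x y := Subtype.ext (map_add e (x : A) y)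
  map_star' x := Subtype.ext (map_star e (x : A))
  map_smul' c x := Subtype.ext (map_smul e c (x : A))

end ClosedIdeal

/-! ## Properties of C*-algebras -/

/-- A property which a C*-algebra may or may not have. -/
abbrev CStarProperty := ∀ (A : Type w) [NonUnitalCStarAlgebra A], Prop

namespace CStarProperty

/-- A property of C*-algebras is isomorphism invariant if it passes to `*`-isomorphic algebras. -/
def IsomorphismInvariant (P : CStarProperty.{w}) : Prop :=
  ∀ (A B : Type w) [NonUnitalCStarAlgebra A] [NonUnitalCStarAlgebra B],
    (A ≃⋆ₐ[ℂ] B) → P A → P B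

/-- A property admits largest ideals if every C*-algebra has a largest closed ideal with it. -/
def AdmitsLargestIdeals (P : CStarProperty.{w}) : Prop :=
  ∀ (A : Type w) [NonUnitalCStarAlgebra A],
    ∃ I : ClosedIdeal A, P I ∧ ∀ J : ClosedIdeal A, P J → J ≤ I

/-- The largest closed ideal of `A` which has the property `P`. -/
def largestIdeal {P : CStarProperty.{w}} (hP : AdmitsLargestIdeals P)
    (A : Type w) [NonUnitalCStarAlgebra A] : ClosedIdeal A :=
  (hP A).choose

theorem largestIdeal_prop {P : CStarProperty.{w}} (hP : AdmitsLargestIdeals P)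
    (A : Type w) [NonUnitalCStarAlgebra A] : P (largestIdeal hP A) :=
  (hP A).choose_spec.1

theorem le_largestIdeal {P : CStarProperty.{w}} (hP : AdmitsLargestIdeals P)
    (A : Type w) [NonUnitalCStarAlgebra A] (J : ClosedIdeal A) (hJ : P J) :
    J ≤ largestIdeal hP A :=
  (hP A).choose_spec.2 J hJ

end CStarProperty

/-! ## Actions of discrete groups

An action of a discrete group `G` on a C*-algebra `A` is a homomorphism from `G` to the group
`A ≃⋆ₐ[ℂ] A` of `*`-automorphisms of `A`. -/

section Action

variable {G : Type v} [Group G] {A : Type w} [NonUnitalCStarAlgebra A]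

/-- Invariance of a closed ideal under an action. -/
def ClosedIdeal.IsInvariant (I : ClosedIdeal A) (α : G →* (A ≃⋆ₐ[ℂ] A)) : Prop :=
  ∀ (g : G) (a : A), a ∈ I → α g a ∈ I

/-- The restriction of an action to an invariant closed ideal. -/
def ClosedIdeal.restrictAction (I : ClosedIdeal A) (α : G →* (A ≃⋆ₐ[ℂ] A))
    (hI : I.IsInvariant α) : G →* (I ≃⋆ₐ[ℂ] I) where
  toFun g :=
    { toFun := fun x => ⟨α g x, hI g x x.2⟩
      invFun := fun x => ⟨α g⁻¹ x, hI g⁻¹ x x.2⟩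
      left_inv := fun x => Subtype.ext <| by
        change α g⁻¹ (α g x) = x
        rw [← StarAlgEquiv.mul_apply, ← map_mul, inv_mul_cancel, map_one, StarAlgEquiv.one_apply]
      right_inv := fun x => Subtype.ext <| by
        change α g (α g⁻¹ x) = x
        rw [← StarAlgEquiv.mul_apply, ← map_mul, mul_inv_cancel, map_one, StarAlgEquiv.one_apply]
      map_mul' := fun x y => Subtype.ext (map_mul (α g) (x : A) y)
      map_add' := fun x y => Subtype.ext (map_add (α g) (x : A) y)
      map_star' := fun x => Subtype.ext (map_star (α g) (x : A))
      map_smul' := fun c x => Subtype.ext (map_smul (α g) c (x : A)) }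
  map_one' := by
    ext x
    change α 1 (x : A) = x
    rw [map_one, StarAlgEquiv.one_apply]
  map_mul' g h := by
    ext x
    change α (g * h) (x : A) = α g (α h x)
    rw [map_mul, StarAlgEquiv.mul_apply]

/-- The largest ideal with an isomorphism invariant property is invariant under every action. -/
theorem CStarProperty.largestIdeal_isInvariant {P : CStarProperty.{w}}
    (hiso : P.IsomorphismInvariant) (hP : P.AdmitsLargestIdeals) (α : G →* (A ≃⋆ₐ[ℂ] A)) :
    (largestIdeal hP A).IsInvariant α := by
  intro g a ha
  have h := le_largestIdeal hP A (ClosedIdeal.image (α g) (largestIdeal hP A))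
    (hiso _ _ (ClosedIdeal.imageEquiv (α g) _) (largestIdeal_prop hP A))
  refine SetLike.coe_subset_coe.mpr h ?_
  change (α g).symm (α g a) ∈ largestIdeal hP A
  rwa [StarAlgEquiv.symm_apply_apply]

end Action

/-! ## The convolution algebra -/

section Convolution

variable {G : Type v} [Group G] {A : Type w} [NonUnitalCStarAlgebra A]

/-- The `*`-algebra `C_c(G, A, α)` of finitely supported functions from the discrete group `G`
to `A`, with `α`-twisted convolution and involution. -/
@[nolint unusedArguments]
def ConvAlg (_α : G →* (A ≃⋆ₐ[ℂ] A)) : Type (max v w) := G →₀ A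

namespace ConvAlg

variable (α : G →* (A ≃⋆ₐ[ℂ] A))

instance : AddCommGroup (ConvAlg α) := inferInstanceAs (AddCommGroup (G →₀ A))

instance : Module ℂ (ConvAlg α) := inferInstanceAs (Module ℂ (G →₀ A))

/-- The function with value `a` at `g` and zero elsewhere. -/
def single (g : G) : A →ₗ[ℂ] ConvAlg α := Finsupp.lsingle g

variable {α}

theorem induction {p : ConvAlg α → Prop} (f : ConvAlg α) (zero : p 0)
    (add : ∀ f g, p f → p g → p (f + g)) (single : ∀ g a, p (single α g a)) : p f :=
  Finsupp.induction_linear f zero add single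

variable (α) in
/-- Linear maps out of the convolution algebra. -/
def lift {M : Type*} [AddCommGroup M] [Module ℂ M] (φ : G → A →ₗ[ℂ] M) : ConvAlg α →ₗ[ℂ] M :=
  Finsupp.lsum ℂ φ

@[simp]
theorem lift_single {M : Type*} [AddCommGroup M] [Module ℂ M] (φ : G → A →ₗ[ℂ] M) (g : G)
    (a : A) : lift α φ (single α g a) = φ g a := by
  exact Finsupp.lsum_single ℂ φ g a

variable (α) in
/-- Twisted convolution, determined by `(a δ_s) (b δ_t) = a α_s(b) δ_{st}`. -/
def mulₗ : ConvAlg α →ₗ[ℂ] ConvAlg α →ₗ[ℂ] ConvAlg α :=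
  lift α fun s => LinearMap.flip (lift α fun t => LinearMap.flip
    (LinearMap.mk₂ ℂ (fun a b => single α (s * t) (a * α s b))
      (by intros; simp [add_mul]) (by intros; simp [smul_mul_assoc])
      (by intros; simp [mul_add]) (by intros; simp [mul_smul_comm])))

instance : Mul (ConvAlg α) := ⟨fun f g => mulₗ α f g⟩

theorem mul_def (f g : ConvAlg α) : f * g = mulₗ α f g := rfl

theorem single_mul_single (s t : G) (a b : A) :
    single α s a * single α t b = single α (s * t) (a * α s b) := by
  simp [mul_def, mulₗ]

variable (α) in
/-- The involution, determined by `(a δ_s)^* = α_{s⁻¹}(a^*) δ_{s⁻¹}`. -/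
def starₗ : ConvAlg α →+ ConvAlg α :=
  Finsupp.liftAddHom fun s => (single α s⁻¹).toAddMonoidHom.comp
    ((AddMonoidHomClass.toAddMonoidHom (α s⁻¹)).comp (starAddEquiv (R := A)).toAddMonoidHom)

instance : Star (ConvAlg α) := ⟨fun f => starₗ α f⟩

theorem star_def (f : ConvAlg α) : star f = starₗ α f := rfl

theorem star_single (s : G) (a : A) : star (single α s a) = single α s⁻¹ (α s⁻¹ (star a)) := by
  rw [star_def]
  exact Finsupp.liftAddHom_apply_single _ _ _

instance : NonUnitalRing (ConvAlg α) where
  left_distrib f g h := map_add (mulₗ α f) g h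
  right_distrib f g h := by simp [mul_def]
  zero_mul f := by simp [mul_def]
  mul_zero f := by simp [mul_def]
  mul_assoc f g h := by
    have add_mul' : ∀ f g h : ConvAlg α, (f + g) * h = f * h + g * h := by simp [mul_def]
    have mul_add' : ∀ f g h : ConvAlg α, f * (g + h) = f * g + f * h := by simp [mul_def]
    have zero_mul' : ∀ f : ConvAlg α, 0 * f = 0 := by simp [mul_def]
    have mul_zero' : ∀ f : ConvAlg α, f * 0 = 0 := by simp [mul_def]
    induction f using ConvAlg.induction with
    | zero => simp only [zero_mul']
    | add f₁ f₂ h₁ h₂ => simp only [add_mul', h₁, h₂]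
    | single r a =>
      induction g using ConvAlg.induction with
      | zero => simp only [zero_mul', mul_zero']
      | add f₁ f₂ h₁ h₂ => simp only [add_mul', mul_add', h₁, h₂]
      | single s b =>
        induction h using ConvAlg.induction with
        | zero => simp only [mul_zero']
        | add f₁ f₂ h₁ h₂ => simp only [mul_add', h₁, h₂]
        | single t c => simp only [single_mul_single, mul_assoc, map_mul, StarAlgEquiv.mul_apply]

instance : IsScalarTower ℂ (ConvAlg α) (ConvAlg α) where
  smul_assoc c f g := by simp [mul_def]

instance : SMulCommClass ℂ (ConvAlg α) (ConvAlg α) where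
  smul_comm c f g := by simp [mul_def]

instance : StarAddMonoid (ConvAlg α) where
  star_involutive f := by
    have star_add' : ∀ f g : ConvAlg α, star (f + g) = star f + star g := by simp [star_def]
    induction f using ConvAlg.induction with
    | zero => simp [star_def]
    | add f₁ f₂ h₁ h₂ => simp only [star_add', h₁, h₂]
    | single s a =>
      rw [star_single, star_single, ← map_star, star_star, ← StarAlgEquiv.mul_apply, ← map_mul]
      simp
  star_add f g := by simp [star_def]

instance : StarRing (ConvAlg α) where
  star_add := star_add
  star_mul f g := by
    induction f using ConvAlg.induction with
    | zero => simp
    | add f₁ f₂ h₁ h₂ => simp only [add_mul, mul_add, star_add, h₁, h₂]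
    | single s a =>
      induction g using ConvAlg.induction with
      | zero => simp
      | add f₁ f₂ h₁ h₂ => simp only [add_mul, mul_add, star_add, h₁, h₂]
      | single t b =>
        simp only [star_single, single_mul_single, star_mul, map_mul, mul_inv_rev, ← map_star,
          StarAlgEquiv.mul_apply]
        rw [← StarAlgEquiv.mul_apply (α s⁻¹) (α s), ← map_mul α, inv_mul_cancel, map_one α,
          StarAlgEquiv.one_apply]

instance : StarModule ℂ (ConvAlg α) where
  star_smul c f := by
    induction f using ConvAlg.induction with
    | zero => simp
    | add f₁ f₂ h₁ h₂ => simp only [smul_add, star_add, h₁, h₂]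
    | single s a =>
      simp only [← map_smul, star_single, star_smul]

end ConvAlg

end Convolution

/-! ## Covariant representations and the universal norm -/

section CovariantRep

variable {G : Type v} [Group G] {A : Type w} [NonUnitalCStarAlgebra A]

/-- A (possibly degenerate) covariant representation of `(G, A, α)` on a Hilbert space `H`. -/
structure CovariantRep (α : G →* (A ≃⋆ₐ[ℂ] A)) (H : Type*) [NormedAddCommGroup H]
    [InnerProductSpace ℂ H] [CompleteSpace H] where
  /-- The representation of the algebra. -/
  π : A →⋆ₙₐ[ℂ] (H →L[ℂ] H)
  /-- The unitary representation of the group. -/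
  U : G →* unitary (H →L[ℂ] H)
  covariant : ∀ (g : G) (a : A),
    π (α g a) = (U g : H →L[ℂ] H) * π a * star (U g : H →L[ℂ] H)

namespace CovariantRep

variable {α : G →* (A ≃⋆ₐ[ℂ] A)} {H : Type*} [NormedAddCommGroup H]
    [InnerProductSpace ℂ H] [CompleteSpace H]

/-- The integrated form `f ↦ ∑ g, π(f(g)) U_g` of a covariant representation. -/
def integrated (ρ : CovariantRep α H) : ConvAlg α →ₗ[ℂ] (H →L[ℂ] H) :=
  ConvAlg.lift α fun g =>
    (LinearMap.mulRight ℂ (ρ.U g : H →L[ℂ] H)).comp (ρ.π : A →ₗ[ℂ] (H →L[ℂ] H))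

@[simp]
theorem integrated_single (ρ : CovariantRep α H) (g : G) (a : A) :
    ρ.integrated (ConvAlg.single α g a) = ρ.π a * (ρ.U g : H →L[ℂ] H) := by
  simp [integrated]

theorem U_mul_π (ρ : CovariantRep α H) (g : G) (a : A) :
    (ρ.U g : H →L[ℂ] H) * ρ.π a = ρ.π (α g a) * (ρ.U g : H →L[ℂ] H) := by
  rw [ρ.covariant, mul_assoc _ (star _) _, Unitary.coe_star_mul_self, mul_one]

theorem integrated_mul (ρ : CovariantRep α H) (f g : ConvAlg α) :
    ρ.integrated (f * g) = ρ.integrated f * ρ.integrated g := by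
  induction f using ConvAlg.induction with
  | zero => simp
  | add f₁ f₂ h₁ h₂ => simp only [add_mul, map_add, h₁, h₂]
  | single s a =>
    induction g using ConvAlg.induction with
    | zero => simp
    | add f₁ f₂ h₁ h₂ => simp only [mul_add, map_add, h₁, h₂]
    | single t b =>
      simp only [ConvAlg.single_mul_single, integrated_single, map_mul, Submonoid.coe_mul]
      rw [mul_assoc (ρ.π a) (ρ.U s : H →L[ℂ] H), ← mul_assoc (ρ.U s : H →L[ℂ] H), ρ.U_mul_π]
      simp only [mul_assoc]

theorem integrated_star (ρ : CovariantRep α H) (f : ConvAlg α) :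
    ρ.integrated (star f) = star (ρ.integrated f) := by
  induction f using ConvAlg.induction with
  | zero => simp
  | add f₁ f₂ h₁ h₂ => simp only [star_add, map_add, h₁, h₂]
  | single s a =>
    rw [ConvAlg.star_single, integrated_single, integrated_single, star_mul, ← ρ.U_mul_π,
      map_star, map_inv]
    rfl

theorem norm_integrated_le (ρ : CovariantRep α H) (f : ConvAlg α) :
    ‖ρ.integrated f‖ ≤ Finsupp.sum (f : G →₀ A) fun _ a => ‖a‖ := by
  change ‖Finsupp.sum (f : G →₀ A) fun g a => ρ.π a * (ρ.U g : H →L[ℂ] H)‖ ≤ _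
  refine (norm_sum_le _ _).trans (Finset.sum_le_sum fun g _ => ?_)
  rw [CStarRing.norm_mul_coe_unitary]
  exact NonUnitalStarAlgHom.norm_apply_le ρ.π _

end CovariantRep

namespace ConvAlg

variable (α : G →* (A ≃⋆ₐ[ℂ] A))

/-- The norms of `f` in the covariant representations of `(G, A, α)`. (Every cyclic covariant
representation lives on a quotient completion of `C_c(G, A)`, so Hilbert spaces in the universe of
`C_c(G, A)` suffice.) -/
def repNorms (f : ConvAlg α) : Set ℝ :=
  {r | ∃ (H : Type (max v w)) (_ : NormedAddCommGroup H) (_ : InnerProductSpace ℂ H)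
    (_ : CompleteSpace H) (ρ : CovariantRep α H), r = ‖ρ.integrated f‖}

/-- The universal C*-seminorm on `C_c(G, A, α)`: the supremum of the norms in all covariant
representations. -/
instance : Norm (ConvAlg α) := ⟨fun f => sSup (repNorms α f)⟩

variable {α}

theorem norm_def (f : ConvAlg α) : ‖f‖ = sSup (repNorms α f) := rfl

theorem bddAbove_repNorms (f : ConvAlg α) : BddAbove (repNorms α f) := by
  refine ⟨Finsupp.sum (f : G →₀ A) fun _ a => ‖a‖, ?_⟩
  rintro _ ⟨H, _, _, _, ρ, rfl⟩
  exact ρ.norm_integrated_le f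

theorem norm_integrated_le_norm {H : Type (max v w)} [NormedAddCommGroup H]
    [InnerProductSpace ℂ H] [CompleteSpace H] (ρ : CovariantRep α H) (f : ConvAlg α) :
    ‖ρ.integrated f‖ ≤ ‖f‖ :=
  le_csSup (bddAbove_repNorms f) ⟨H, _, _, _, ρ, rfl⟩

theorem norm_le_of_forall (f : ConvAlg α) {c : ℝ} (hc : 0 ≤ c)
    (h : ∀ (H : Type (max v w)) [NormedAddCommGroup H] [InnerProductSpace ℂ H] [CompleteSpace H]
      (ρ : CovariantRep α H), ‖ρ.integrated f‖ ≤ c) : ‖f‖ ≤ c := by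
  refine Real.sSup_le ?_ hc
  rintro _ ⟨H, _, _, _, ρ, rfl⟩
  exact h H ρ

theorem norm_nonneg' (f : ConvAlg α) : 0 ≤ ‖f‖ := by
  refine Real.sSup_nonneg ?_
  rintro _ ⟨H, _, _, _, ρ, rfl⟩
  exact norm_nonneg _

instance : SeminormedAddCommGroup (ConvAlg α) :=
  SeminormedAddCommGroup.ofCore (𝕜 := ℂ)
    { norm_nonneg := norm_nonneg'
      norm_smul := by
        have key : ∀ (c : ℂ) (f : ConvAlg α), ‖c • f‖ ≤ ‖c‖ * ‖f‖ := fun c f =>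
          norm_le_of_forall _ (mul_nonneg (norm_nonneg _) (norm_nonneg' _)) fun H _ _ _ ρ => by
            rw [map_smul, norm_smul]
            gcongr
            exact norm_integrated_le_norm ρ f
        intro c f
        refine le_antisymm (key c f) ?_
        rcases eq_or_ne c 0 with rfl | hc
        · simp only [norm_zero, zero_mul]
          exact norm_nonneg' _
        · have h := key c⁻¹ (c • f)
          rw [inv_smul_smul₀ hc, norm_inv] at h
          have hc' : 0 < ‖c‖ := norm_pos_iff.mpr hc
          calc ‖c‖ * ‖f‖ ≤ ‖c‖ * (‖c‖⁻¹ * ‖c • f‖) := by gcongr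
            _ = ‖c • f‖ := by rw [mul_inv_cancel_left₀ hc'.ne']
      norm_triangle := fun f g =>
        norm_le_of_forall _ (add_nonneg (norm_nonneg' _) (norm_nonneg' _)) fun H _ _ _ ρ => by
          rw [map_add]
          exact (norm_add_le _ _).trans
            (add_le_add (norm_integrated_le_norm ρ f) (norm_integrated_le_norm ρ g)) }

instance : NormedSpace ℂ (ConvAlg α) where
  norm_smul_le c f := norm_le_of_forall _ (by positivity) fun H _ _ _ ρ => by
    rw [map_smul, norm_smul]
    gcongr
    exact norm_integrated_le_norm ρ f

theorem norm_mul_le' (f g : ConvAlg α) : ‖f * g‖ ≤ ‖f‖ * ‖g‖ :=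
  norm_le_of_forall _ (by positivity) fun H _ _ _ ρ => by
    rw [ρ.integrated_mul]
    exact (norm_mul_le _ _).trans (mul_le_mul (norm_integrated_le_norm ρ f)
      (norm_integrated_le_norm ρ g) (norm_nonneg _) (norm_nonneg _))

theorem norm_star_le (f : ConvAlg α) : ‖star f‖ ≤ ‖f‖ :=
  norm_le_of_forall _ (norm_nonneg _) fun H _ _ _ ρ => by
    rw [ρ.integrated_star, norm_star]
    exact norm_integrated_le_norm ρ f

theorem norm_mul_self_le' (f : ConvAlg α) : ‖f‖ * ‖f‖ ≤ ‖star f * f‖ := by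
  have h : ‖f‖ ≤ √‖star f * f‖ :=
    norm_le_of_forall _ (Real.sqrt_nonneg _) fun H _ _ _ ρ => by
      refine Real.le_sqrt_of_sq_le ?_
      rw [sq, ← CStarRing.norm_star_mul_self, ← ρ.integrated_star, ← ρ.integrated_mul]
      exact norm_integrated_le_norm ρ _
  calc ‖f‖ * ‖f‖ ≤ √‖star f * f‖ * √‖star f * f‖ := by gcongr
    _ = ‖star f * f‖ := Real.mul_self_sqrt (norm_nonneg _)

end ConvAlg

end CovariantRep

/-! ## The crossed product -/

section CrossedProduct

variable {G : Type v} [Group G] {A : Type w} [NonUnitalCStarAlgebra A]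

/-- The (full) crossed product `C^*(G, A, α)` of a C*-algebra by an action of a discrete group:
the Hausdorff completion of `C_c(G, A, α)` in the universal C*-seminorm. -/
def CrossedProduct (α : G →* (A ≃⋆ₐ[ℂ] A)) : Type (max v w) :=
  UniformSpace.Completion (ConvAlg α)

namespace CrossedProduct

variable (α : G →* (A ≃⋆ₐ[ℂ] A))

instance : NormedAddCommGroup (CrossedProduct α) :=
  inferInstanceAs (NormedAddCommGroup (UniformSpace.Completion (ConvAlg α)))

instance : NormedSpace ℂ (CrossedProduct α) :=
  inferInstanceAs (NormedSpace ℂ (UniformSpace.Completion (ConvAlg α)))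

instance : CompleteSpace (CrossedProduct α) :=
  inferInstanceAs (CompleteSpace (UniformSpace.Completion (ConvAlg α)))

/-- The canonical map from `C_c(G, A, α)` to the crossed product. -/
def of : ConvAlg α →ₗᵢ[ℂ] CrossedProduct α := UniformSpace.Completion.toComplₗᵢ

variable {α}

theorem induction {p : CrossedProduct α → Prop} (x : CrossedProduct α)
    (closed : IsClosed {x | p x}) (of : ∀ f, p (of α f)) : p x :=
  UniformSpace.Completion.induction_on x closed of

variable (α) in
/-- Extension of bounded linear maps from `C_c(G, A, α)` to the crossed product. -/
def extend {E : Type*} [NormedAddCommGroup E] [NormedSpace ℂ E] [CompleteSpace E]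
    (T : ConvAlg α →L[ℂ] E) : CrossedProduct α →L[ℂ] E :=
  ContinuousLinearMap.fromCompletion T

@[simp]
theorem extend_of {E : Type*} [NormedAddCommGroup E] [NormedSpace ℂ E] [CompleteSpace E]
    (T : ConvAlg α →L[ℂ] E) (f : ConvAlg α) : extend α T (of α f) = T f :=
  ContinuousLinearMap.fromCompletion_apply_coe T f

theorem norm_extend_le {E : Type*} [NormedAddCommGroup E] [NormedSpace ℂ E] [CompleteSpace E]
    (T : ConvAlg α →L[ℂ] E) {c : ℝ} (h : ∀ f, ‖T f‖ ≤ c * ‖f‖) (x : CrossedProduct α) :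
    ‖extend α T x‖ ≤ c * ‖x‖ := by
  induction x using CrossedProduct.induction with
  | closed => exact isClosed_le (by fun_prop) (by fun_prop)
  | of f => simpa using h f

variable (α) in
/-- Left multiplication by an element of `C_c(G, A, α)`. -/
def mulLeftL (f : ConvAlg α) : CrossedProduct α →L[ℂ] CrossedProduct α :=
  extend α (LinearMap.mkContinuous ((of α).toLinearMap ∘ₗ ConvAlg.mulₗ α f) ‖f‖ fun g => by
    change ‖of α (f * g)‖ ≤ _
    rw [LinearIsometry.norm_map]
    exact ConvAlg.norm_mul_le' f g)

theorem mulLeftL_of (f g : ConvAlg α) : mulLeftL α f (of α g) = of α (f * g) := by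
  rw [mulLeftL, extend_of]
  rfl

theorem norm_mulLeftL_le (f : ConvAlg α) : ‖mulLeftL α f‖ ≤ ‖f‖ :=
  ContinuousLinearMap.opNorm_le_bound _ (norm_nonneg _) <| norm_extend_le _ fun g => by
    change ‖of α (f * g)‖ ≤ _
    rw [LinearIsometry.norm_map]
    exact ConvAlg.norm_mul_le' f g

variable (α) in
/-- Left multiplication, as a linear map. -/
def mulLeftₗ : ConvAlg α →ₗ[ℂ] (CrossedProduct α →L[ℂ] CrossedProduct α) where
  toFun := mulLeftL α
  map_add' f g := by
    ext x
    induction x using CrossedProduct.induction with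
    | closed => exact isClosed_eq (map_continuous _) (map_continuous _)
    | of h =>
      rw [add_apply, mulLeftL_of, mulLeftL_of, mulLeftL_of, add_mul, map_add]
  map_smul' c f := by
    ext x
    induction x using CrossedProduct.induction with
    | closed => exact isClosed_eq (map_continuous _) (map_continuous _)
    | of h =>
      rw [RingHom.id_apply, smul_apply, mulLeftL_of, mulLeftL_of,
        smul_mul_assoc, map_smul]

variable (α) in
/-- The multiplication of the crossed product, extending convolution by continuity. -/
def mulL : CrossedProduct α →L[ℂ] CrossedProduct α →L[ℂ] CrossedProduct α :=
  extend α (LinearMap.mkContinuous (mulLeftₗ α) 1 fun f => by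
    rw [one_mul]
    exact norm_mulLeftL_le f)

instance : Mul (CrossedProduct α) := ⟨fun x y => mulL α x y⟩

theorem mul_def (x y : CrossedProduct α) : x * y = mulL α x y := rfl

theorem of_mul (f g : ConvAlg α) : of α (f * g) = of α f * of α g := by
  rw [mul_def, mulL, extend_of]
  exact (mulLeftL_of f g).symm

instance : ContinuousMul (CrossedProduct α) where
  continuous_mul := by
    change Continuous fun p : CrossedProduct α × CrossedProduct α => mulL α p.1 p.2
    fun_prop

instance : Star (CrossedProduct α) :=
  ⟨UniformSpace.Completion.map (star : ConvAlg α → ConvAlg α)⟩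

theorem uniformContinuous_star_conv : UniformContinuous (star : ConvAlg α → ConvAlg α) :=
  LipschitzWith.uniformContinuous (K := 1) <| LipschitzWith.of_dist_le_mul fun f g => by
    rw [dist_eq_norm, dist_eq_norm, ← star_sub, NNReal.coe_one, one_mul]
    exact ConvAlg.norm_star_le _

theorem of_star (f : ConvAlg α) : of α (star f) = star (of α f) :=
  (UniformSpace.Completion.map_coe uniformContinuous_star_conv f).symm

instance : ContinuousStar (CrossedProduct α) where
  continuous_star := UniformSpace.Completion.continuous_map

instance : NonUnitalNormedRing (CrossedProduct α) where
  __ := (inferInstance : NormedAddCommGroup (CrossedProduct α))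
  left_distrib x y z := map_add (mulL α x) y z
  right_distrib x y z := by simp [mul_def]
  zero_mul x := by simp [mul_def]
  mul_zero x := by simp [mul_def]
  mul_assoc x y z := by
    induction x using CrossedProduct.induction with
    | closed => exact isClosed_eq (by fun_prop) (by fun_prop)
    | of f =>
      induction y using CrossedProduct.induction with
      | closed => exact isClosed_eq (by fun_prop) (by fun_prop)
      | of g =>
        induction z using CrossedProduct.induction with
        | closed => exact isClosed_eq (by fun_prop) (by fun_prop)
        | of h => simp only [← of_mul, mul_assoc]
  norm_mul_le x y := by
    induction x using CrossedProduct.induction with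
    | closed => exact isClosed_le (by fun_prop) (by fun_prop)
    | of f =>
      induction y using CrossedProduct.induction with
      | closed => exact isClosed_le (by fun_prop) (by fun_prop)
      | of g =>
        simp only [← of_mul, LinearIsometry.norm_map]
        exact ConvAlg.norm_mul_le' f g

instance : StarRing (CrossedProduct α) where
  star_involutive x := by
    induction x using CrossedProduct.induction with
    | closed => exact isClosed_eq (by fun_prop) (by fun_prop)
    | of f => rw [← of_star, ← of_star, star_star]
  star_mul x y := by
    induction x using CrossedProduct.induction with
    | closed => exact isClosed_eq (by fun_prop) (by fun_prop)
    | of f =>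
      induction y using CrossedProduct.induction with
      | closed => exact isClosed_eq (by fun_prop) (by fun_prop)
      | of g => simp only [← of_mul, ← of_star, star_mul]
  star_add x y := by
    induction x using CrossedProduct.induction with
    | closed => exact isClosed_eq (by fun_prop) (by fun_prop)
    | of f =>
      induction y using CrossedProduct.induction with
      | closed => exact isClosed_eq (by fun_prop) (by fun_prop)
      | of g => simp only [← map_add, ← of_star, star_add]

theorem star_smul' (c : ℂ) (x : CrossedProduct α) : star (c • x) = star c • star x := by
  have h1 : Continuous fun x : CrossedProduct α => star (c • x) :=
    continuous_star.comp (continuous_const_smul (T := CrossedProduct α) c)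
  have h2 : Continuous fun x : CrossedProduct α => star c • star x :=
    (continuous_const_smul (T := CrossedProduct α) (star c)).comp continuous_star
  induction x using CrossedProduct.induction with
  | closed => exact isClosed_eq h1 h2
  | of f => rw [← map_smul, ← of_star, ← of_star, star_smul, map_smul]

/-- The crossed product is a C*-algebra. -/
instance : NonUnitalCStarAlgebra (CrossedProduct α) where
  norm_mul_self_le x := by
    induction x using CrossedProduct.induction with
    | closed => exact isClosed_le (by fun_prop) (by fun_prop)
    | of f =>
      simp only [← of_star, ← of_mul, LinearIsometry.norm_map]
      exact ConvAlg.norm_mul_self_le' f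
  norm_smul_le := norm_smul_le
  smul_assoc c x y := by
    change mulL α (c • x) y = c • mulL α x y
    simp
  smul_comm c x y := by
    change c • mulL α x y = mulL α x (c • y)
    simp
  star_smul := star_smul'

variable (α) in
/-- The canonical embedding of `A` in `C^*(G, A, α)`, sending `a` to `a δ_1`. -/
def embed : A →⋆ₙₐ[ℂ] CrossedProduct α where
  toFun a := of α (ConvAlg.single α 1 a)
  map_smul' c a := by rw [map_smul, map_smul]; rfl
  map_zero' := by rw [map_zero, map_zero]
  map_add' a b := by rw [map_add, map_add]
  map_mul' a b := by
    rw [← of_mul, ConvAlg.single_mul_single, mul_one, map_one, StarAlgEquiv.one_apply]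
  map_star' a := by
    rw [← of_star, ConvAlg.star_single, inv_one, map_one, StarAlgEquiv.one_apply]

end CrossedProduct

/-! ### Functoriality for equivariant homomorphisms -/

variable {B : Type w} [NonUnitalCStarAlgebra B]
  {α : G →* (A ≃⋆ₐ[ℂ] A)} {β : G →* (B ≃⋆ₐ[ℂ] B)}

/-- Pull back a covariant representation along an equivariant homomorphism. -/
def CovariantRep.comap {H : Type*} [NormedAddCommGroup H] [InnerProductSpace ℂ H]
    [CompleteSpace H] (φ : A →⋆ₙₐ[ℂ] B) (hφ : ∀ g a, φ (α g a) = β g (φ a))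
    (ρ : CovariantRep β H) : CovariantRep α H where
  π := ρ.π.comp φ
  U := ρ.U
  covariant g a := by
    change ρ.π (φ (α g a)) = _
    rw [hφ, ρ.covariant]
    rfl

variable (α β) in
/-- The map `a δ_g ↦ φ(a) δ_g` of convolution algebras. -/
def ConvAlg.map (φ : A →⋆ₙₐ[ℂ] B) : ConvAlg α →ₗ[ℂ] ConvAlg β :=
  ConvAlg.lift α fun g => (ConvAlg.single β g).comp (φ : A →ₗ[ℂ] B)

@[simp]
theorem ConvAlg.map_single (φ : A →⋆ₙₐ[ℂ] B) (g : G) (a : A) :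
    ConvAlg.map α β φ (ConvAlg.single α g a) = ConvAlg.single β g (φ a) := by
  simp [ConvAlg.map]

theorem ConvAlg.map_mul' (φ : A →⋆ₙₐ[ℂ] B) (hφ : ∀ g a, φ (α g a) = β g (φ a))
    (f g : ConvAlg α) :
    ConvAlg.map α β φ (f * g) = ConvAlg.map α β φ f * ConvAlg.map α β φ g := by
  induction f using ConvAlg.induction with
  | zero => simp
  | add f₁ f₂ h₁ h₂ => simp only [add_mul, map_add, h₁, h₂]
  | single s a =>
    induction g using ConvAlg.induction with
    | zero => simp
    | add f₁ f₂ h₁ h₂ => simp only [mul_add, map_add, h₁, h₂]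
    | single t b => simp only [single_mul_single, map_single, map_mul, hφ]

theorem ConvAlg.map_star' (φ : A →⋆ₙₐ[ℂ] B) (hφ : ∀ g a, φ (α g a) = β g (φ a))
    (f : ConvAlg α) : ConvAlg.map α β φ (star f) = star (ConvAlg.map α β φ f) := by
  induction f using ConvAlg.induction with
  | zero => simp
  | add f₁ f₂ h₁ h₂ => simp only [star_add, map_add, h₁, h₂]
  | single s a => simp only [star_single, map_single, map_star, hφ]

theorem ConvAlg.norm_map_le (φ : A →⋆ₙₐ[ℂ] B) (hφ : ∀ g a, φ (α g a) = β g (φ a))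
    (f : ConvAlg α) : ‖ConvAlg.map α β φ f‖ ≤ ‖f‖ :=
  norm_le_of_forall _ (norm_nonneg _) fun H _ _ _ ρ => by
    have h : ρ.integrated (ConvAlg.map α β φ f) = (ρ.comap φ hφ).integrated f := by
      induction f using ConvAlg.induction with
      | zero => simp
      | add f₁ f₂ h₁ h₂ => simp only [map_add, h₁, h₂]
      | single s a =>
        rw [map_single, CovariantRep.integrated_single, CovariantRep.integrated_single]
        rfl
    rw [h]
    exact norm_integrated_le_norm _ f

namespace CrossedProduct

/-- The underlying bounded linear map of `CrossedProduct.map`. -/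
def mapL (φ : A →⋆ₙₐ[ℂ] B) (hφ : ∀ g a, φ (α g a) = β g (φ a)) :
    CrossedProduct α →L[ℂ] CrossedProduct β :=
  extend α (LinearMap.mkContinuous ((of β).toLinearMap ∘ₗ ConvAlg.map α β φ) 1 fun f => by
    change ‖of β (ConvAlg.map α β φ f)‖ ≤ _
    rw [LinearIsometry.norm_map, one_mul]
    exact ConvAlg.norm_map_le φ hφ f)

theorem mapL_of (φ : A →⋆ₙₐ[ℂ] B) (hφ : ∀ g a, φ (α g a) = β g (φ a)) (f : ConvAlg α) :
    mapL φ hφ (of α f) = of β (ConvAlg.map α β φ f) := by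
  rw [mapL, extend_of]
  rfl

/-- The homomorphism `C^*(G, A, α) → C^*(G, B, β)` induced by an equivariant homomorphism
`φ : A → B`; it sends `a δ_g` to `φ(a) δ_g`. -/
def map (φ : A →⋆ₙₐ[ℂ] B) (hφ : ∀ g a, φ (α g a) = β g (φ a)) :
    CrossedProduct α →⋆ₙₐ[ℂ] CrossedProduct β where
  toFun := mapL φ hφ
  map_smul' := map_smul (mapL φ hφ)
  map_zero' := map_zero (mapL φ hφ)
  map_add' := map_add (mapL φ hφ)
  map_mul' x y := by
    induction x using CrossedProduct.induction with
    | closed => exact isClosed_eq (by fun_prop) (by fun_prop)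
    | of f =>
      induction y using CrossedProduct.induction with
      | closed => exact isClosed_eq (by fun_prop) (by fun_prop)
      | of g => simp only [← of_mul, mapL_of, ConvAlg.map_mul' φ hφ]
  map_star' x := by
    induction x using CrossedProduct.induction with
    | closed => exact isClosed_eq (by fun_prop) (by fun_prop)
    | of f => simp only [← of_star, mapL_of, ConvAlg.map_star' φ hφ]

/-- For an invariant closed ideal `I` of `A`, the canonical homomorphism
`C^*(G, I, α) → C^*(G, A, α)`, by which `C^*(G, I, α)` is regarded as a subset (indeed a closed
ideal) of `C^*(G, A, α)`. -/
def idealMap (α : G →* (A ≃⋆ₐ[ℂ] A)) (I : ClosedIdeal A) (hI : I.IsInvariant α) :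
    CrossedProduct (I.restrictAction α hI) →⋆ₙₐ[ℂ] CrossedProduct α :=
  map I.incl fun _ _ => rfl

end CrossedProduct

end CrossedProduct

end

noncomputable section

open Filter Topology
open scoped InnerProductSpace

/-! Write I for the largest ideal of A with the property. Two facts about crossed products carry the
proof.

First, for an invariant ideal I the canonical map from C*(G, I) to C*(G, A) is isometric and its
range is a closed ideal (`isometry_idealMap`, `mul_mem_range_idealMap`). Under (1) this range has
the property, being isomorphic to C*(G, I), so it lies in the largest such ideal; this is (2).
Restricting (2) to the elements a δ_1 gives (3).

Second, a closed ideal of C*(G, A) containing every a δ_1 is all of C*(G, A) (`mem_of_embed_mem`):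
if e runs through an approximate unit of A, then (e δ_1)(a δ_g) = (ea) δ_g tends to a δ_g. If A has
the property, then I = A, so under (3) the largest ideal of C*(G, A) contains A. It is therefore the
whole crossed product, and (1) follows.

The substantial point is the isometry. Since the norm is a supremum over covariant representations,
it is enough that each covariant representation (π, U) of I extends to A on the same Hilbert space
with the same U. As π may be degenerate, H is split into the closed span of π(I)H and the vectors
killed by π(I). The extension sends a to the strong limit of π(ae) along a contractive approximate
unit of I: it maps π(i)η to π(ai)η and is zero on the second summand. These two conditions determine
it, so algebraic identities need checking only on the two kinds of vectors (`ext_of_rep`). -/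

/-- Every C*-algebra has a two-sided approximate unit in its closed unit ball. -/
theorem exists_contractive_approximateUnit (B : Type*) [NonUnitalCStarAlgebra B] :
    ∃ l : Filter B, l.IsApproximateUnit ∧ ∀ᶠ e in l, ‖e‖ ≤ 1 := by
  let _ := CStarAlgebra.spectralOrder B
  have _ := CStarAlgebra.spectralOrderedRing B
  have h := CStarAlgebra.increasingApproximateUnit B
  exact ⟨_, h.toIsApproximateUnit, h.eventually_norm⟩

/-! ## Extension of representations from ideals -/

section Extension

variable {H : Type*} [NormedAddCommGroup H] [InnerProductSpace ℂ H] [CompleteSpace H]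

/-! ### Range and null vectors of a possibly degenerate representation. -/

section General

variable {B : Type*} [NonUnitalCStarAlgebra B] (π : B →⋆ₙₐ[ℂ] (H →L[ℂ] H))

theorem inner_rep_left (b : B) (ξ η : H) : ⟪π b ξ, η⟫_ℂ = ⟪ξ, π (star b) η⟫_ℂ := by
  rw [map_star, ContinuousLinearMap.star_eq_adjoint, ContinuousLinearMap.adjoint_inner_right]

/-- A closed subspace containing the range of a representation and all vectors annihilated by
it is the whole space. -/
theorem submodule_eq_top_of_rep (S : Submodule ℂ H) (hS : IsClosed (S : Set H))
    (hrange : ∀ b η, π b η ∈ S) (hnull : ∀ ξ, (∀ b, π b ξ = 0) → ξ ∈ S) : S = ⊤ := by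
  have : CompleteSpace S := hS.completeSpace_coe
  -- If ξ is orthogonal to S, then ‖π(b)ξ‖² = ⟪ξ, π(b*)π(b)ξ⟫ = 0 for all b. Hence ξ is a null
  -- vector, lies in S as well, and is orthogonal to itself.
  rw [← Submodule.orthogonal_eq_bot_iff, Submodule.eq_bot_iff]
  intro ξ hξ
  have h0 : ξ ∈ S := hnull ξ fun b => by
    rw [← inner_self_eq_zero (𝕜 := ℂ), inner_rep_left]
    exact Submodule.inner_left_of_mem_orthogonal (hrange _ _) hξ
  exact inner_self_eq_zero.mp (Submodule.inner_right_of_mem_orthogonal h0 hξ)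

/-- Bounded operators agreeing on the range of a representation and on the vectors annihilated by
it are equal. -/
theorem ext_of_rep {E : Type*} [NormedAddCommGroup E] [NormedSpace ℂ E] {S T : H →L[ℂ] E}
    (hrange : ∀ b η, S (π b η) = T (π b η))
    (hnull : ∀ ξ, (∀ b, π b ξ = 0) → S ξ = T ξ) : S = T := by
  have h := submodule_eq_top_of_rep π (LinearMap.ker (S - T : H →L[ℂ] E).toLinearMap)
    (S - T).isClosed_ker
    (fun b η => by simp [hrange b η]) (fun ξ hξ => by simp [hnull ξ hξ])
  ext ξ
  have hξ : ξ ∈ LinearMap.ker (S - T : H →L[ℂ] E).toLinearMap := h ▸ Submodule.mem_top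
  simpa [sub_eq_zero] using hξ

end General

/-! ### Extending a representation of an ideal to the whole algebra. -/

variable {A : Type w} [NonUnitalCStarAlgebra A] {I : ClosedIdeal A}

/-- Left multiplication of an element of a closed ideal by an element of the algebra. -/
def ClosedIdeal.mulLeft (I : ClosedIdeal A) (a : A) (x : I) : I := ⟨a * x, I.mul_mem_left a x.2⟩

theorem ClosedIdeal.coe_mulLeft (a : A) (x : I) : (I.mulLeft a x : A) = a * x := rfl

theorem ClosedIdeal.mulLeft_mul (a : A) (x y : I) : I.mulLeft a (x * y) = I.mulLeft a x * y :=
  Subtype.ext (mul_assoc a (x : A) y).symm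

theorem ClosedIdeal.norm_mulLeft_le (a : A) (x : I) : ‖I.mulLeft a x‖ ≤ ‖a‖ * ‖x‖ :=
  norm_mul_le a (x : A)

theorem ClosedIdeal.continuous_mulLeft (a : A) : Continuous (I.mulLeft a) :=
  (continuous_const.mul continuous_subtype_val).subtype_mk _

variable (π : I →⋆ₙₐ[ℂ] (H →L[ℂ] H))

/-- The bound is uniform over the unit ball of I. It makes the set of vectors with a strong limit
closed, and it survives as the bound on the limit operator. -/
theorem norm_rep_mulLeft_le (a : A) {e : I} (he : ‖e‖ ≤ 1) (ξ : H) :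
    ‖π (I.mulLeft a e) ξ‖ ≤ ‖a‖ * ‖ξ‖ := by
  refine ((π (I.mulLeft a e)).le_opNorm ξ).trans ?_
  gcongr
  refine (NonUnitalStarAlgHom.norm_apply_le π _).trans ((I.norm_mulLeft_le a e).trans ?_)
  exact mul_le_of_le_one_right (norm_nonneg a) he

/-- Here π(ae)π(i)η = π(a(ei))η, and ei tends to i. -/
theorem tendsto_rep_mulLeft (a : A) {l : Filter I} (hl : l.IsApproximateUnit) (i : I) (η : H) :
    Tendsto (fun e => π (I.mulLeft a e) (π i η)) l (𝓝 (π (I.mulLeft a i) η)) := by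
  have hπ : Continuous π := AddMonoidHomClass.continuous_of_bound π 1 fun x => by
    rw [one_mul]
    exact NonUnitalStarAlgHom.norm_apply_le π x
  have h1 : Tendsto (fun e => π (I.mulLeft a (e * i)) η) l (𝓝 (π (I.mulLeft a i) η)) :=
    ((((ContinuousLinearMap.apply ℂ H η).continuous.comp hπ).comp
      (I.continuous_mulLeft a)).tendsto i).comp (hl.tendsto_mul_right i)
  simpa [I.mulLeft_mul] using h1

/-- Strong convergence of `π (a * e)` along a contractive approximate unit. -/
theorem exists_tendsto_rep_mulLeft (a : A) {l : Filter I} (hl : l.IsApproximateUnit)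
    (hl1 : ∀ᶠ e in l, ‖e‖ ≤ 1) (ξ : H) :
    ∃ ζ, Tendsto (fun e => π (I.mulLeft a e) ξ) l (𝓝 ζ) := by
  have := hl.neBot
  -- S collects the vectors at which the limit exists. Once closed, it is all of H: it contains the
  -- range by the preceding lemma, and on null vectors the net is constantly 0.
  let S : Submodule ℂ H :=
    { carrier := {ξ | ∃ ζ, Tendsto (fun e => π (I.mulLeft a e) ξ) l (𝓝 ζ)}
      add_mem' := by
        rintro ξ η ⟨x, hx⟩ ⟨y, hy⟩
        exact ⟨x + y, by simpa using hx.add hy⟩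
      zero_mem' := ⟨0, by simp⟩
      smul_mem' := by
        rintro c ξ ⟨x, hx⟩
        exact ⟨c • x, by simpa using hx.const_smul c⟩ }
  have hbound : ∀ᶠ e in l, ∀ ξ, ‖π (I.mulLeft a e) ξ‖ ≤ ‖a‖ * ‖ξ‖ := by
    filter_upwards [hl1] with e he ξ
    exact norm_rep_mulLeft_le π a he ξ
  have hS : IsClosed (S : Set H) := by
    refine isClosed_of_closure_subset fun ξ hξ => ?_
    change ∃ ζ, Tendsto (fun e => π (I.mulLeft a e) ξ) l (𝓝 ζ)
    -- Since H is complete, a Cauchy estimate suffices. It is a three-term estimate through a nearby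
    -- η in S, the uniform bound controlling the two outer terms.
    rw [← cauchy_map_iff_exists_tendsto, cauchy_map_iff',
      Metric.uniformity_basis_dist.tendsto_right_iff]
    intro ε hε
    obtain ⟨δ, hδ, hδε⟩ : ∃ δ > 0, ‖a‖ * δ < ε / 3 := by
      -- Adding 1 to ‖a‖ covers the case a = 0.
      refine ⟨ε / 3 / (‖a‖ + 1), by positivity, ?_⟩
      rw [← mul_div_assoc, div_lt_iff₀ (by positivity)]
      nlinarith [norm_nonneg a]
    obtain ⟨η, ⟨y, hy⟩, hη⟩ := Metric.mem_closure_iff.mp hξ δ hδ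
    have hc := cauchy_map_iff'.mp (cauchy_map_iff_exists_tendsto.mpr ⟨y, hy⟩)
    have hc' := Metric.uniformity_basis_dist.tendsto_right_iff.mp hc (ε / 3) (by positivity)
    have hb : ∀ᶠ e in l, dist (π (I.mulLeft a e) ξ) (π (I.mulLeft a e) η) < ε / 3 := by
      filter_upwards [hbound] with e he
      rw [dist_eq_norm, ← map_sub]
      refine (he _).trans_lt (lt_of_le_of_lt ?_ hδε)
      rw [← dist_eq_norm]
      gcongr
    filter_upwards [hc', hb.prod_mk hb] with p h1 h2
    have h3 := h2.2
    rw [dist_comm] at h3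
    have h1' : dist (π (I.mulLeft a p.1) η) (π (I.mulLeft a p.2) η) < ε / 3 := h1
    have := dist_triangle4 (π (I.mulLeft a p.1) ξ) (π (I.mulLeft a p.1) η)
      (π (I.mulLeft a p.2) η) (π (I.mulLeft a p.2) ξ)
    change dist (π (I.mulLeft a p.1) ξ) (π (I.mulLeft a p.2) ξ) < ε
    linarith [h2.1]
  have h := submodule_eq_top_of_rep π S hS
    (fun i η => ⟨_, tendsto_rep_mulLeft π a hl i η⟩)
    (fun ξ hξ => ⟨0, by simp [hξ]⟩)
  exact (h ▸ Submodule.mem_top : ξ ∈ S)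

theorem exists_repExtend (a : A) : ∃ T : H →L[ℂ] H,
    (∀ i η, T (π i η) = π (I.mulLeft a i) η) ∧ ∀ ξ, (∀ i, π i ξ = 0) → T ξ = 0 := by
  obtain ⟨l, hl, hl1⟩ := exists_contractive_approximateUnit I
  have := hl.neBot
  choose T hT using exists_tendsto_rep_mulLeft π a hl hl1
  let L : H →ₗ[ℂ] H := linearMapOfTendsto T (fun e => (π (I.mulLeft a e)).toLinearMap)
    (tendsto_pi_nhds.mpr hT)
  refine ⟨L.mkContinuous ‖a‖ fun ξ => ?_, fun i η => ?_, fun ξ hξ => ?_⟩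
  · refine le_of_tendsto (hT ξ).norm ?_
    filter_upwards [hl1] with e he
    exact norm_rep_mulLeft_le π a he ξ
  · exact tendsto_nhds_unique (hT (π i η)) (tendsto_rep_mulLeft π a hl i η)
  · refine tendsto_nhds_unique (hT ξ) ?_
    simp [hξ]

/-- The extension of a representation of a closed ideal to a bounded operator for each element of
the algebra, vanishing on the vectors annihilated by the ideal. -/
def repExtend (a : A) : H →L[ℂ] H := (exists_repExtend π a).choose

theorem repExtend_rep (a : A) (i : I) (η : H) :
    repExtend π a (π i η) = π (I.mulLeft a i) η :=
  (exists_repExtend π a).choose_spec.1 i η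

theorem repExtend_null (a : A) {ξ : H} (hξ : ∀ i, π i ξ = 0) : repExtend π a ξ = 0 :=
  (exists_repExtend π a).choose_spec.2 ξ hξ

/-- This is the working tool for everything below: linearity, multiplicativity, compatibility with
the star and agreement with π on I are all obtained by checking the two characterizing conditions.
-/
theorem repExtend_unique (a : A) {T : H →L[ℂ] H}
    (hT : ∀ i η, T (π i η) = π (I.mulLeft a i) η) (hT0 : ∀ ξ, (∀ i, π i ξ = 0) → T ξ = 0) :
    repExtend π a = T :=
  ext_of_rep π (fun i η => by rw [repExtend_rep, hT])
    fun ξ hξ => by rw [repExtend_null π a hξ, hT0 ξ hξ]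

/-- On range vectors both sides give π(iaj)η, and both kill null vectors. Taking adjoints here
describes the adjoint of `repExtend π a` on the range of π. -/
theorem rep_mul_repExtend (i : I) (a : A) :
    π i * repExtend π a = π ⟨i * a, I.mul_mem_right a i.2⟩ := by
  refine ext_of_rep π (fun j η => ?_) fun ξ hξ => ?_
  · rw [mul_apply_eq_comp, repExtend_rep, ← mul_apply_eq_comp,
      ← mul_apply_eq_comp, ← map_mul, ← map_mul]
    congr 2
    exact Subtype.ext (mul_assoc (i : A) a j).symm
  · rw [mul_apply_eq_comp, repExtend_null π a hξ, map_zero, hξ]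

theorem repExtend_star (a : A) : repExtend π (star a) = star (repExtend π a) := by
  refine repExtend_unique π _ (fun i η => ?_) fun ξ hξ => ?_
  -- The adjoint of π(i*) T_a = π(i*a) is T_a* π(i) = π(a*i), where T_a is `repExtend π a`.
  · have h := congrArg star (rep_mul_repExtend π (star i) a)
    rw [star_mul, ← map_star, ← map_star, star_star] at h
    rw [← mul_apply_eq_comp, h]
    congr 2
    exact Subtype.ext (by simp [ClosedIdeal.coe_mulLeft])
  · refine ext_inner_right ℂ fun η => ?_
    rw [inner_zero_left, ContinuousLinearMap.star_eq_adjoint,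
      ContinuousLinearMap.adjoint_inner_left]
    -- For a null vector ξ, the functional η ↦ ⟪ξ, T_a η⟫ vanishes on range vectors, because ⟪ξ,
    -- π(ai)η⟫ = ⟪π((ai)*)ξ, η⟫ = 0, and on null vectors, because T_a kills them.
    have h : (innerSL ℂ ξ).comp (repExtend π a) = 0 := by
      refine ext_of_rep π (fun i η => ?_) fun ζ hζ => ?_
      · simp only [ContinuousLinearMap.comp_apply, repExtend_rep, innerSL_apply_apply,
          zero_apply]
        rw [← star_star (I.mulLeft a i), ← inner_rep_left, hξ, inner_zero_left]
      · simp [repExtend_null π a hζ]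
    exact congrArg (fun f : H →L[ℂ] ℂ => f η) h

/-- The canonical extension of a representation of a closed ideal to the algebra. -/
def repExtendHom : A →⋆ₙₐ[ℂ] (H →L[ℂ] H) where
  toFun := repExtend π
  map_smul' c a := repExtend_unique π _
    (fun i η => by
      have h : I.mulLeft (c • a) i = c • I.mulLeft a i := Subtype.ext (smul_mul_assoc c a (i : A))
      simp [repExtend_rep, h])
    fun ξ hξ => by simp [repExtend_null π a hξ]
  map_zero' := repExtend_unique π _
    (fun i η => by
      have h : I.mulLeft 0 i = 0 := Subtype.ext (zero_mul (i : A))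
      simp [h])
    fun ξ hξ => by simp
  map_add' a b := repExtend_unique π _
    (fun i η => by
      have h : I.mulLeft (a + b) i = I.mulLeft a i + I.mulLeft b i :=
        Subtype.ext (add_mul a b (i : A))
      simp [repExtend_rep, h])
    fun ξ hξ => by simp [repExtend_null π _ hξ]
  map_mul' a b := repExtend_unique π _
    (fun i η => by
      have h : I.mulLeft (a * b) i = I.mulLeft a (I.mulLeft b i) :=
        Subtype.ext (mul_assoc a b (i : A))
      simp [repExtend_rep, h])
    fun ξ hξ => by simp [repExtend_null π b hξ]
  map_star' := repExtend_star π

theorem repExtendHom_apply (a : A) : repExtendHom π a = repExtend π a := rfl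

theorem repExtendHom_coe (i : I) : repExtendHom π (i : A) = π i :=
  repExtend_unique π _
    (fun j η => by
      rw [← mul_apply_eq_comp, ← map_mul]
      rfl)
    fun ξ hξ => hξ i

end Extension

/-! ### Extending covariant representations. -/

section CovariantExtension

variable {G : Type v} [Group G] {A : Type w} [NonUnitalCStarAlgebra A]
  {α : G →* (A ≃⋆ₐ[ℂ] A)} {I : ClosedIdeal A} {hI : I.IsInvariant α}
  {H : Type*} [NormedAddCommGroup H] [InnerProductSpace ℂ H] [CompleteSpace H]

/-- The extension of a covariant representation from an invariant ideal. -/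
def CovariantRep.extendIdeal (ρ : CovariantRep (I.restrictAction α hI) H) : CovariantRep α H where
  π := repExtendHom ρ.π
  U := ρ.U
  covariant g a := by
    -- In this intertwining form, covariance can be tested on range vectors and null vectors
    -- separately.
    have hcomm : repExtend ρ.π (α g a) * (ρ.U g : H →L[ℂ] H)
        = (ρ.U g : H →L[ℂ] H) * repExtend ρ.π a := by
      refine ext_of_rep ρ.π (fun i η => ?_) fun ξ hξ => ?_
      · have h1 := fun i => DFunLike.congr_fun (ρ.U_mul_π g i) η
        simp only [mul_apply_eq_comp] at h1 ⊢
        rw [h1, repExtend_rep, repExtend_rep, h1]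
        congr 2
        exact Subtype.ext (map_mul (α g) a (i : A)).symm
      · simp only [mul_apply_eq_comp]
        rw [repExtend_null ρ.π a hξ, map_zero, repExtend_null]
        -- U_g preserves the null vectors: π(i) U_g ξ = U_g π(α_{g⁻¹}(i)) ξ = 0.
        intro i
        have h1 := DFunLike.congr_fun (ρ.U_mul_π g (I.restrictAction α hI g⁻¹ i)) ξ
        simp only [mul_apply_eq_comp] at h1
        rw [hξ, map_zero, ← StarAlgEquiv.mul_apply, ← map_mul, mul_inv_cancel, map_one,
          StarAlgEquiv.one_apply] at h1
        exact h1.symm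
    rw [repExtendHom_apply, repExtendHom_apply, ← hcomm, mul_assoc,
      Unitary.mul_star_self_of_mem (ρ.U g).2, mul_one]

/-- Because H and U are kept, every operator norm entering the universal norm over I also enters the
one over A. -/
theorem CovariantRep.extendIdeal_integrated (ρ : CovariantRep (I.restrictAction α hI) H)
    (f : ConvAlg (I.restrictAction α hI)) :
    ρ.extendIdeal.integrated (ConvAlg.map _ α I.incl f) = ρ.integrated f := by
  induction f using ConvAlg.induction with
  | zero => simp
  | add f₁ f₂ h₁ h₂ => simp only [map_add, h₁, h₂]
  | single s a =>
    rw [ConvAlg.map_single, CovariantRep.integrated_single, CovariantRep.integrated_single]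
    congr 1
    exact repExtendHom_coe ρ.π a

end CovariantExtension

/-! ## Ideals of crossed products -/

namespace CrossedProduct

variable {G : Type v} [Group G] {A : Type w} [NonUnitalCStarAlgebra A]
  (α : G →* (A ≃⋆ₐ[ℂ] A))

theorem idealMap_of (I : ClosedIdeal A) (hI : I.IsInvariant α)
    (f : ConvAlg (I.restrictAction α hI)) :
    idealMap α I hI (of _ f) = of α (ConvAlg.map _ α I.incl f) :=
  mapL_of I.incl (fun _ _ => rfl) f

theorem continuous_idealMap (I : ClosedIdeal A) (hI : I.IsInvariant α) :
    Continuous (idealMap α I hI) :=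
  map_continuous (mapL (β := α) I.incl fun _ _ => rfl)

/-- The map is contractive because covariant representations of A restrict to I. It does not shrink
norms because those of I extend to A. -/
theorem isometry_idealMap (I : ClosedIdeal A) (hI : I.IsInvariant α) :
    Isometry (idealMap α I hI) := by
  refine AddMonoidHomClass.isometry_of_norm _ fun x => ?_
  induction x using CrossedProduct.induction with
  | closed => exact isClosed_eq (continuous_idealMap α I hI).norm continuous_norm
  | of f =>
    rw [idealMap_of, LinearIsometry.norm_map, LinearIsometry.norm_map]
    refine le_antisymm (ConvAlg.norm_map_le _ (fun _ _ => rfl) f) ?_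
    refine ConvAlg.norm_le_of_forall f (norm_nonneg _) fun H _ _ _ ρ => ?_
    rw [← ρ.extendIdeal_integrated]
    exact ConvAlg.norm_integrated_le_norm _ _

/-- The range of an isometry on a complete space is closed, so density reduces the claim to (a
δ_s)(b δ_t) = a α_s(b) δ_{st}. The coefficient lies in I by invariance. -/
theorem mul_mem_range_idealMap (I : ClosedIdeal A) (hI : I.IsInvariant α) (x : CrossedProduct α)
    (y : CrossedProduct (I.restrictAction α hI)) :
    x * idealMap α I hI y ∈ Set.range (idealMap α I hI) := by
  have hcl := (isometry_idealMap α I hI).isClosedEmbedding.isClosed_range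
  have hadd : ∀ u v, u ∈ Set.range (idealMap α I hI) → v ∈ Set.range (idealMap α I hI) →
      u + v ∈ Set.range (idealMap α I hI) := by
    rintro _ _ ⟨u, rfl⟩ ⟨v, rfl⟩
    exact ⟨u + v, map_add _ u v⟩
  have hzero : 0 ∈ Set.range (idealMap α I hI) := ⟨0, map_zero _⟩
  induction x using CrossedProduct.induction with
  | closed => exact hcl.preimage (f := fun x => x * idealMap α I hI y) (by fun_prop)
  | of f =>
    induction y using CrossedProduct.induction with
    | closed =>
      exact hcl.preimage (continuous_const.mul (continuous_idealMap α I hI))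
    | of g =>
      rw [idealMap_of]
      induction f using ConvAlg.induction with
      | zero => simpa using hzero
      | add f₁ f₂ h₁ h₂ =>
        rw [map_add, add_mul]
        exact hadd _ _ h₁ h₂
      | single s a =>
        induction g using ConvAlg.induction with
        | zero => simpa using hzero
        | add g₁ g₂ h₁ h₂ =>
          rw [map_add, map_add, mul_add]
          exact hadd _ _ h₁ h₂
        | single t b =>
          refine ⟨of _ (ConvAlg.single _ (s * t) (I.mulLeft a ⟨α s b, hI s b b.2⟩)), ?_⟩
          rw [idealMap_of, ConvAlg.map_single, ConvAlg.map_single, ← of_mul,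
            ConvAlg.single_mul_single]
          rfl

/-- The crossed product by an invariant ideal, as a closed ideal of the crossed product. -/
def rangeIdeal (I : ClosedIdeal A) (hI : I.IsInvariant α) : ClosedIdeal (CrossedProduct α) where
  carrier := Set.range (idealMap α I hI)
  add_mem' := by
    rintro _ _ ⟨u, rfl⟩ ⟨v, rfl⟩
    exact ⟨u + v, map_add _ u v⟩
  zero_mem' := ⟨0, map_zero _⟩
  smul_mem' := by
    rintro c _ ⟨u, rfl⟩
    exact ⟨c • u, map_smul _ c u⟩
  mul_mem_left' := by
    rintro x _ ⟨y, rfl⟩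
    exact mul_mem_range_idealMap α I hI x y
  mul_mem_right' := by
    rintro _ x ⟨y, rfl⟩
    -- Right absorption follows from left absorption through yx = (x* y*)*.
    obtain ⟨z, hz⟩ := mul_mem_range_idealMap α I hI (star x) (star y)
    refine ⟨star z, ?_⟩
    rw [map_star, hz, star_mul, star_star, map_star, star_star]
  isClosed' := (isometry_idealMap α I hI).isClosedEmbedding.isClosed_range

/-- The crossed product by an invariant ideal is isomorphic to its image. -/
def rangeIdealEquiv (I : ClosedIdeal A) (hI : I.IsInvariant α) :
    CrossedProduct (I.restrictAction α hI) ≃⋆ₐ[ℂ] rangeIdeal α I hI where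
  __ := Equiv.ofInjective (idealMap α I hI) (isometry_idealMap α I hI).injective
  map_mul' x y := Subtype.ext (map_mul (idealMap α I hI) x y)
  map_add' x y := Subtype.ext (map_add (idealMap α I hI) x y)
  map_star' x := Subtype.ext (map_star (idealMap α I hI) x)
  map_smul' c x := Subtype.ext (map_smul (idealMap α I hI) c x)

/-! ### Generation of the crossed product, as an ideal, by the coefficient algebra. -/

theorem norm_of_single_le (g : G) (a : A) : ‖of α (ConvAlg.single α g a)‖ ≤ ‖a‖ := by
  rw [LinearIsometry.norm_map]
  refine ConvAlg.norm_le_of_forall _ (norm_nonneg a) fun H _ _ _ ρ => ?_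
  rw [ρ.integrated_single, CStarRing.norm_mul_coe_unitary]
  exact NonUnitalStarAlgHom.norm_apply_le ρ.π a

theorem continuous_of_single (g : G) : Continuous fun a => of α (ConvAlg.single α g a) :=
  map_continuous (LinearMap.mkContinuous ((of α).toLinearMap ∘ₗ ConvAlg.single α g) 1 fun a => by
    rw [one_mul]
    exact norm_of_single_le α g a)

/-- A closed ideal of the crossed product containing the coefficient algebra is everything. -/
theorem mem_of_embed_mem (J : ClosedIdeal (CrossedProduct α)) (hJ : ∀ a, embed α a ∈ J)
    (x : CrossedProduct α) : x ∈ J := by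
  induction x using CrossedProduct.induction with
  | closed => exact J.isClosed
  | of f =>
    induction f using ConvAlg.induction with
    | zero => rw [map_zero]; exact zero_mem J
    | add f₁ f₂ h₁ h₂ => rw [map_add]; exact add_mem h₁ h₂
    | single g a =>
      obtain ⟨l, hl, -⟩ := exists_contractive_approximateUnit A
      have := hl.neBot
      -- The element a δ_g is the limit of (ea) δ_g = (e δ_1)(a δ_g), and each of these products
      -- lies in J.
      refine J.isClosed.mem_of_tendsto
        (((continuous_of_single α g).tendsto a).comp (hl.tendsto_mul_right a))
        (.of_forall fun e => ?_)
      have h := J.mul_mem_right (of α (ConvAlg.single α g a)) (hJ e)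
      change of α (ConvAlg.single α 1 e) * _ ∈ J at h
      rwa [← of_mul, ConvAlg.single_mul_single, one_mul, map_one, StarAlgEquiv.one_apply] at h

end CrossedProduct

/-! ### The whole algebra as an ideal of itself, and the equivalence. -/

/-- A closed ideal containing every element is isomorphic to the algebra. -/
def ClosedIdeal.equivOfForallMem {A : Type w} [NonUnitalCStarAlgebra A] (I : ClosedIdeal A)
    (hI : ∀ a, a ∈ I) : I ≃⋆ₐ[ℂ] A where
  toFun x := x
  invFun a := ⟨a, hI a⟩
  left_inv _ := rfl
  right_inv _ := rfl
  map_mul' _ _ := rfl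
  map_add' _ _ := rfl
  map_star' _ := rfl
  map_smul' _ _ := rfl

/-- The trivial closed ideal consisting of all elements. -/
def ClosedIdeal.univ (A : Type w) [NonUnitalCStarAlgebra A] : ClosedIdeal A where
  __ := (⊤ : Submodule ℂ A)
  mul_mem_left' _ _ _ := trivial
  mul_mem_right' _ _ := trivial
  isClosed' := isClosed_univ

theorem CStarProperty.mem_largestIdeal_of_prop {P : CStarProperty.{w}}
    (hiso : P.IsomorphismInvariant) (hmax : P.AdmitsLargestIdeals) {A : Type w}
    [NonUnitalCStarAlgebra A] (hA : P A) (a : A) : a ∈ largestIdeal hmax A :=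
  le_largestIdeal hmax A (ClosedIdeal.univ A)
    (hiso _ _ ((ClosedIdeal.univ A).equivOfForallMem fun _ => trivial).symm hA)
    (trivial : a ∈ ClosedIdeal.univ A)

end

/-- With coefficient algebras in `Type (max u v)` and G in `Type v`, crossed products stay in `Type
(max u v)`, so the same P applies to both. -/
theorem theorem3p4 (P : CStarProperty.{max u v}) (hiso : P.IsomorphismInvariant)
    (hmax : P.AdmitsLargestIdeals) (G : Type v) [CommGroup G] :
    List.TFAE [
      ∀ (A : Type (max u v)) [NonUnitalCStarAlgebra A] (α : G →* (A ≃⋆ₐ[ℂ] A)),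
        P A → P (CrossedProduct α),
      ∀ (A : Type (max u v)) [NonUnitalCStarAlgebra A] (α : G →* (A ≃⋆ₐ[ℂ] A)),
        Set.range (CrossedProduct.idealMap α (CStarProperty.largestIdeal hmax A)
            (CStarProperty.largestIdeal_isInvariant hiso hmax α))
          ⊆ (CStarProperty.largestIdeal hmax (CrossedProduct α) : Set (CrossedProduct α)),
      ∀ (A : Type (max u v)) [NonUnitalCStarAlgebra A] (α : G →* (A ≃⋆ₐ[ℂ] A)),
        CrossedProduct.embed α '' (CStarProperty.largestIdeal hmax A : Set A)
          ⊆ (CStarProperty.largestIdeal hmax (CrossedProduct α) : Set (CrossedProduct α))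
            ∩ Set.range (CrossedProduct.embed α)] := by
  tfae_have 1 → 2 := fun h A _ α =>
    CStarProperty.le_largestIdeal hmax _ (CrossedProduct.rangeIdeal α _ _)
      (hiso _ _ (CrossedProduct.rangeIdealEquiv α _ _)
        (h _ _ (CStarProperty.largestIdeal_prop hmax A)))
  tfae_have 2 → 3 := by
    rintro h A _ α _ ⟨a, ha, rfl⟩
    -- The preimage of a δ_1 is a δ_1 formed over the ideal.
    refine ⟨h A α ⟨CrossedProduct.embed _ ⟨a, ha⟩, ?_⟩, a, rfl⟩
    change CrossedProduct.idealMap α _ _ (CrossedProduct.of _ _) = CrossedProduct.of α _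
    rw [CrossedProduct.idealMap_of, ConvAlg.map_single]
    rfl
  -- When A has the property, (3) puts every a δ_1 into the largest ideal of the crossed product.
  -- That ideal is then everything and passes its property on by isomorphism.
  tfae_have 3 → 1 := fun h A _ α hA =>
    hiso _ _ (ClosedIdeal.equivOfForallMem _ (CrossedProduct.mem_of_embed_mem α _ fun a =>
        (h A α ⟨a, CStarProperty.mem_largestIdeal_of_prop hiso hmax hA a, rfl⟩).1))
      (CStarProperty.largestIdeal_prop hmax (CrossedProduct α))
  tfae_finish
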